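/- For a continuous map $p\colon E\to B$ let ${\sf secat}(p)\in\{0,1,2,\ldots,\infty\}$ be the smallest $n$ such that $B$ is covered by $n+1$ open sets $U_0,\ldots,U_n$ on each of which $p$ has a continuous section $U_i\to E$ (and $\infty$ if there is no such $n$). For a based space $(X,*)$ let ${\sf cat}(X)={\sf secat}(PX\to X)$, where $PX$ is the space of paths $\gamma\colon[0,1]\to X$ with $\gamma(0)=*$ and the map is $\gamma\mapsto\gamma(1)$. For $r\ge 2$ let ${\sf TC}_r(X)={\sf secat}(p_r)$, where $p_r\colon X^{[0,1]}\to X^r$, $p_r(\alpha)=\left(\alpha(0),\alpha\left(\tfrac{1}{r-1}\right),\ldots,\alpha\left(\tfrac{r-2}{r-1}\right),\alpha(1)\right)$. Path spaces carry the compact-open topology. Let $K$ be a simplicial complex on vertices $[m]=\{1,\ldots,m\}$ and let $\{(X_i,*)\}_{i=1}^m$ be any family of based topological spaces. Let $\underline{X}^K\subseteq\prod_{i=1}^m X_i$ be the polyhedral product, that is, the subspace of all $(x_1,\ldots,x_m)$ for which there is a simplex $\sigma$ of $K$ with $x_i=*$ for all $i\notin\sigma$. For a simplex $\sigma$ of $K$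 put $X^{\sigma}=\prod_{i\in\sigma}X_i$, based at the point all of whose coordinates are base points; products carry the product topology and the product base point. Let $r\ge2$ and let $\sigma_1,\ldots,\sigma_r$ be an $r$-tuple of simplices of $K$ (the empty simplex is allowed) such that $\sigma_j\cap\sigma_k=\varnothing$ for some $j\neq k$. Then $${\sf cat}\left(X^{\sigma_1}\times X^{\sigma_2}\times\cdots\times X^{\sigma_r}\right)\le{\sf TC}_r\left(\underline{X}^K\right).$$ -/

import Mathlib

open Set

noncomputable section

/-- `p : E → B` has `n + 1` local sections over open sets that cover `B`. -/
def HasSectionalCover {E B : Type*} [TopologicalSpace E] [TopologicalSpace B]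
    (p : E → B) (n : ℕ) : Prop :=
  ∃ U : Fin (n + 1) → Set B,
    (∀ k, IsOpen (U k)) ∧ (⋃ k, U k) = univ ∧
      ∀ k, ∃ s : U k → E, Continuous s ∧ ∀ b : U k, p (s b) = b

/-- The (reduced) sectional category of `p`: the least `n` such that `B` is covered by `n + 1` open
sets over which `p` has a continuous section, and `⊤` if there is no such `n`. -/
def secat {E B : Type*} [TopologicalSpace E] [TopologicalSpace B] (p : E → B) : ℕ∞ :=
  ⨅ (n : ℕ) (_ : HasSectionalCover p n), (n : ℕ∞)

/-- The space of paths in `X` that start at `x₀`, with the compact-open topology. -/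
abbrev BasedPaths (X : Type*) [TopologicalSpace X] (x₀ : X) : Type _ :=
  {γ : C(unitInterval, X) // γ 0 = x₀}

/-- The (reduced) Lusternik-Schnirelmann category of the based space `(X, x₀)`: the sectional
category of the endpoint map on based paths. -/
def lsCat (X : Type*) [TopologicalSpace X] (x₀ : X) : ℕ∞ :=
  secat (fun γ : BasedPaths X x₀ => γ.1 1)

/-- The time `j / (r - 1)`, for `j = 0, …, r - 1`. -/
def stopTime {r : ℕ} (j : Fin r) : unitInterval :=
  ⟨(j : ℝ) / ((r : ℝ) - 1), by
    have h : ((j : ℕ) : ℝ) + 1 ≤ (r : ℝ) := by exact_mod_cast j.isLt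
    have h0 : (0 : ℝ) ≤ ((j : ℕ) : ℝ) := Nat.cast_nonneg _
    exact ⟨div_nonneg h0 (by linarith), div_le_one_of_le₀ (by linarith) (by linarith)⟩⟩

/-- The `r`-th (reduced, sequential) topological complexity of `X`, `r ≥ 2`: the sectional category
of `X^[0,1] → X^r`, `α ↦ (α(0), α(1/(r-1)), …, α(1))`. -/
def seqTC (r : ℕ) (X : Type*) [TopologicalSpace X] : ℕ∞ :=
  secat (fun (α : C(unitInterval, X)) (j : Fin r) => α (stopTime j))

/-- `σ` is a simplex of `K`. Mathlib lists only the nonempty simplices as faces; the empty simplex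
is counted here as well. -/
def IsSimplex {m : ℕ} (K : PreAbstractSimplicialComplex (Fin m)) (σ : Finset (Fin m)) : Prop :=
  σ = ∅ ∨ σ ∈ K.faces

/-- The polyhedral product of the based spaces `(X i, pt i)` along `K`, as a subspace of `∏ i, X i`:
the union over the simplices `σ` of `K` of the sets of those `x` with `x i = pt i` for `i ∉ σ`. -/
def polyhedralProduct {m : ℕ} (K : PreAbstractSimplicialComplex (Fin m)) {X : Fin m → Type*}
    (pt : ∀ i, X i) : Set (∀ i, X i) :=
  ⋃ (σ : Finset (Fin m)) (_ : IsSimplex K σ), {x | ∀ i, i ∉ σ → x i = pt i}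

/-- The product `X^σ = ∏_{i ∈ σ} X i`. -/
abbrev SubProduct {m : ℕ} (X : Fin m → Type*) (σ : Finset (Fin m)) : Type _ :=
  ∀ i : {i : Fin m // i ∈ σ}, X i.1

end

/-! Extension by base points maps the product of the `X^σ_j` into the `r`-th power of the polyhedral
product. Let `α` be a path whose stops are the image of `x`. Two of the simplices are disjoint, so
each vertex `i` is missed by some `σ_l`, and coordinate `i` of `α` is the base point at stop `l`.
Running that coordinate from stop `l` to stop `j`, backwards if need be, joins the base point to `x
j i`. Coordinates may use different time intervals because the target is a full product. This is
continuous in `α`, so local sections of `p_r` pull back to local sections of the based path map. -/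

/-- If every point of the pullback of `p : E → B` along `f : B' → B` yields, continuously, a point of
`E'` over the corresponding point of `B'`, then `secat q ≤ secat p`. -/
theorem secat_le_of_pullback {E B E' B' : Type*} [TopologicalSpace E] [TopologicalSpace B]
    [TopologicalSpace E'] [TopologicalSpace B'] {p : E → B} {q : E' → B'} {f : B' → B}
    (hf : Continuous f) (g : {x : E × B' // p x.1 = f x.2} → E') (hg : Continuous g)
    (hqg : ∀ x, q (g x) = x.1.2) : secat q ≤ secat p := by
  refine le_iInf₂ fun n ⟨U, hUo, hUc, hUs⟩ => iInf₂_le n ⟨fun k => f ⁻¹' U k, ?_, ?_, ?_⟩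
  · exact fun k => (hUo k).preimage hf
  · rw [← preimage_iUnion, hUc, preimage_univ]
  · intro k
    obtain ⟨s, hs, hps⟩ := hUs k
    -- A section of `p` over `U k`, precomposed with `f`, lands in the pullback, where `g` applies.
    refine ⟨fun b => g ⟨(s ⟨f b, b.2⟩, b), hps ⟨f b, b.2⟩⟩, hg.comp ?_, fun b => hqg _⟩
    exact ((hs.comp ((hf.comp continuous_subtype_val).subtype_mk _)).prodMk
      continuous_subtype_val).subtype_mk _

/-- The affine map of the unit interval to itself that takes `0` to `a` and `1` to `b`. -/
def affineReparam (a b t : unitInterval) : unitInterval :=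
  ⟨(1 - t) * a + t * b, convex_Icc (0 : ℝ) 1 a.2 b.2 (unitInterval.one_minus_nonneg t)
    (unitInterval.nonneg t) (sub_add_cancel 1 _)⟩

theorem affineReparam_zero (a b : unitInterval) : affineReparam a b 0 = a := by
  ext; simp [affineReparam]

theorem affineReparam_one (a b : unitInterval) : affineReparam a b 1 = b := by
  ext; simp [affineReparam]

theorem continuous_affineReparam (a b : unitInterval) : Continuous (affineReparam a b) :=
  Continuous.subtype_mk (by fun_prop) _

section PolyhedralProduct

variable {m : ℕ} {X : Fin m → Type*}

/-- Extension of a point of `X^σ` to a point of `∏ i, X i` by base points. -/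
def extendByBasePoint (pt : ∀ i, X i) (σ : Finset (Fin m)) (x : SubProduct X σ) : ∀ i, X i :=
  fun i => if h : i ∈ σ then x ⟨i, h⟩ else pt i

theorem extendByBasePoint_of_mem (pt : ∀ i, X i) {σ : Finset (Fin m)} (x : SubProduct X σ)
    (i : {i : Fin m // i ∈ σ}) : extendByBasePoint pt σ x i.1 = x i :=
  dif_pos i.2

theorem extendByBasePoint_of_notMem (pt : ∀ i, X i) {σ : Finset (Fin m)} (x : SubProduct X σ)
    {i : Fin m} (h : i ∉ σ) : extendByBasePoint pt σ x i = pt i :=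
  dif_neg h

theorem continuous_extendByBasePoint [∀ i, TopologicalSpace (X i)] (pt : ∀ i, X i)
    (σ : Finset (Fin m)) : Continuous (extendByBasePoint pt σ) := by
  refine continuous_pi fun i => ?_
  by_cases h : i ∈ σ
  · simpa only [extendByBasePoint, dif_pos h] using continuous_apply _
  · simpa only [extendByBasePoint, dif_neg h] using continuous_const

theorem extendByBasePoint_mem_polyhedralProduct {K : PreAbstractSimplicialComplex (Fin m)}
    (pt : ∀ i, X i) {σ : Finset (Fin m)} (hσ : IsSimplex K σ) (x : SubProduct X σ) :
    extendByBasePoint pt σ x ∈ polyhedralProduct K pt :=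
  mem_iUnion₂.2 ⟨σ, hσ, fun _ h => extendByBasePoint_of_notMem pt x h⟩

end PolyhedralProduct

theorem corollary5 {m r : ℕ} (K : PreAbstractSimplicialComplex (Fin m))
    (X : Fin m → Type*) [∀ i, TopologicalSpace (X i)] (pt : ∀ i, X i)
    (σ : Fin r → Finset (Fin m)) (hσ : ∀ j, IsSimplex K (σ j))
    (hdisj : ∃ j k : Fin r, j ≠ k ∧ Disjoint (σ j) (σ k)) :
    lsCat (∀ j : Fin r, SubProduct X (σ j)) (fun _ i => pt i.1) ≤
      seqTC r (polyhedralProduct K pt) := by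
  obtain ⟨a, b, -, hab⟩ := hdisj
  have hl : ∀ i : Fin m, ∃ l : Fin r, i ∉ σ l := fun i => by
    by_cases h : i ∈ σ a
    · exact ⟨b, Finset.disjoint_left.1 hab h⟩
    · exact ⟨a, h⟩
  choose l hl using hl
  let f : (∀ j : Fin r, SubProduct X (σ j)) → Fin r → polyhedralProduct K pt := fun x j =>
    ⟨extendByBasePoint pt (σ j) (x j), extendByBasePoint_mem_polyhedralProduct pt (hσ j) (x j)⟩
  have hf : Continuous f := continuous_pi fun j =>
    ((continuous_extendByBasePoint pt (σ j)).comp (continuous_apply j)).subtype_mk _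
  -- The coordinate `i` of `α` is the base point at the time of the stop `l i`, because `i ∉ σ (l i)`.
  let φ : C(unitInterval, polyhedralProduct K pt) → unitInterval →
      ∀ j : Fin r, SubProduct X (σ j) :=
    fun α t j i => (α (affineReparam (stopTime (l i.1)) (stopTime j) t)).1 i.1
  -- Joint continuity rests on that of evaluation, as the interval is locally compact; currying then
  -- gives continuity into the path space.
  have hφ : Continuous (Function.uncurry φ) := by
    refine continuous_pi fun j => continuous_pi fun i => ?_
    have h := continuous_affineReparam (stopTime (l i.1)) (stopTime j)
    exact (continuous_apply i.1).comp (continuous_subtype_val.comp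
      (continuous_eval.comp (continuous_fst.prodMk (h.comp continuous_snd))))
  refine secat_le_of_pullback hf
    (fun x => ⟨⟨φ x.1.1, hφ.comp (Continuous.prodMk_right x.1.1)⟩, ?_⟩) ?_ ?_
  · funext j i
    have h := congrArg Subtype.val (congrFun x.2 (l i.1))
    change (x.1.1 (affineReparam (stopTime (l i.1)) (stopTime j) 0)).1 i.1 = pt i.1
    rw [affineReparam_zero]
    exact (congrFun h i.1).trans (extendByBasePoint_of_notMem pt _ (hl i.1))
  · refine Continuous.subtype_mk (ContinuousMap.continuous_of_continuous_uncurry _ ?_) _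
    exact hφ.comp (((continuous_fst.comp continuous_subtype_val).comp continuous_fst).prodMk
      continuous_snd)
  · intro x
    funext j i
    have h := congrArg Subtype.val (congrFun x.2 j)
    change (x.1.1 (affineReparam (stopTime (l i.1)) (stopTime j) 1)).1 i.1 = x.1.2 j i
    rw [affineReparam_one]
    exact (congrFun h i.1).trans (extendByBasePoint_of_mem pt _ i)
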